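/- For each $n\ge 1$ let $K(n)\ge 1$ be an integer, let $p_n=(p_n(i))_{1\le i\le K(n)}$ be a nonuniform probability distribution (the numbers $p_n(i)$, $1\le i\le K(n)$, are not all equal), and let $X_{1,n},\dots,X_{n,n}$ be independent random variables with $\mathbb P(X_{k,n}=i)=p_n(i)$ for $1\le i\le K(n)$. Put $$H_n=-\sum_{i=1}^{K(n)}p_n(i)\ln p_n(i),\qquad \sigma_n^2=\sum_{i=1}^{K(n)}p_n(i)\ln^2p_n(i)-\Big(\sum_{i=1}^{K(n)}p_n(i)\ln p_n(i)\Big)^2,\quad \sigma_n\ge 0,$$ $$\hat p_n(i)=\frac1n\sum_{k=1}^n \mathbf 1_{\{X_{k,n}=i\}},\qquad \hat H_n=-\sum_{i=1}^{K(n)}\hat p_n(i)\ln\hat p_n(i),\qquad T_{1,n}=-\sum_{i=1}^{K(n)}\big(\mathbf 1_{\{X_{1,n}=i\}}-p_n(i)\big)\ln p_n(i),$$ with the convention that terms containing $\ln 0$ are $0$, and that a quotient by $\sigma_n$ is $0$ if $\sigma_n=0$ (the last assumption below allows $\sigma_n=0$ or $p_n(i)=0$ for at most finitely many $n$). Assume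 that there is $\delta>0$ with $$\sup_{n\ge1}\mathbb E\exp\Big(\frac{\delta}{\sigma_n}|T_{1,n}|\Big)<\infty .$$ Let $(b_n)_{n\ge1}$ be a sequence of positive numbers such that $b_n\to\infty$, $b_n/\sqrt n\to0$, and, for every $\varepsilon>0$, $$\lim_{n\to\infty}\frac1{b_n^2}\log\Big[\sum_{i=1}^{K(n)}\exp\big(-2\varepsilon\sqrt n\,b_n\sigma_n\,p_n(i)^2\big)\Big]=-\infty .$$ Then for every $r>0$, $$\lim_{n\to\infty}\frac1{b_n^2}\log\mathbb P\Big(\frac{\sqrt n}{b_n\sigma_n}\,|\hat H_n-H_n|>r\Big)=-\frac{r^2}{2}.$$ -/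

import Mathlib

open MeasureTheory ProbabilityTheory Filter Topology

noncomputable section

/-- Shannon's entropy `-∑ p(i) ln p(i)` (natural logarithm, with `0 ln 0 = 0`). -/
def shannonEntropy {α : Type*} [Fintype α] (p : α → ℝ) : ℝ :=
  -∑ i, p i * Real.log (p i)

/-- `∑ p(i) ln² p(i) - (∑ p(i) ln p(i))²`, the variance of `ln p(X)` for `X` with law `p`. -/
def logVariance {α : Type*} [Fintype α] (p : α → ℝ) : ℝ :=
  ∑ i, p i * Real.log (p i) ^ 2 - (∑ i, p i * Real.log (p i)) ^ 2

/-- The standard deviation of `ln p(X)` for `X` with law `p`. -/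
def logStdDev {α : Type*} [Fintype α] (p : α → ℝ) : ℝ :=
  Real.sqrt (logVariance p)

/-- The empirical distribution of the sample `x 0, …, x (n - 1)`. -/
def empiricalDist {α : Type*} [DecidableEq α] {n : ℕ} (x : Fin n → α) (i : α) : ℝ :=
  (1 / (n : ℝ)) * ∑ j, if x j = i then (1 : ℝ) else 0

/-- The plug-in estimator of the entropy: the entropy of the empirical distribution. -/
def plugInEntropy {α : Type*} [Fintype α] [DecidableEq α] {n : ℕ} (x : Fin n → α) : ℝ :=
  shannonEntropy (empiricalDist x)

/-- `T = -∑ (1{x = i} - p(i)) ln p(i)`, as a function of the single observation `x`. -/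
def centeredLogTerm {α : Type*} [Fintype α] [DecidableEq α] (p : α → ℝ) (x : α) : ℝ :=
  -∑ i, ((if x = i then (1 : ℝ) else 0) - p i) * Real.log (p i)

end

/-! The estimation error splits exactly: `Ĥ - H` is the mean over the sample of the centered terms
`T_k`, minus the relative entropy of the empirical law with respect to `p`. The first part carries
the deviations, and the second is negligible at speed `b²`.

Linear part. The variables `T_k / σ` are i.i.d. with mean 0, variance 1 and a uniformly bounded
exponential moment. Their moment generating function at `l = θ b / √n → 0` is therefore `1 + l²/2 +
O(|l|³)`, and the scaled cumulant generating functions of the normalized sums tend to `θ²/2`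
(`tendsto_cgf_sum_of_iIndepFun`). This gives the Gaussian rate `r²/2`: from above by Chernoff, from
below because the exponential moment with parameter near `r` is carried by a small window just above
`r`.

Relative entropy. It lies between 0 and `s²` as soon as `|p̂(i) - p(i)| ≤ s p(i)` for every `i`
(`sum_mul_log_sub_log_mem_Icc`). Hoeffding and a union bound give failure probability at most `2 ∑
exp(-2 n s² p(i)²)`. For `s² = ε b σ / √n` this is twice the sum in the growth condition, hence
superexponentially small. `tendsto_log_measureReal_abs_gt` combines the two parts. -/

/-! ### Moderate deviations from convergence of scaled cumulant generating functions. -/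

/-- Exponential two-sided bounds on `q` determine its logarithmic rate. -/
lemma tendsto_log_rate_of_exp_bounds {a q : ℕ → ℝ} {c : ℝ} (ha : Tendsto a atTop atTop)
    (hlow : ∀ η > 0, ∀ᶠ n in atTop, Real.exp (-(a n * (c + η))) ≤ q n)
    (hup : ∀ η > 0, ∀ᶠ n in atTop, q n ≤ Real.exp (-(a n * (c - η)))) :
    Tendsto (fun n => 1 / a n * Real.log (q n)) atTop (𝓝 (-c)) := by
  rw [Metric.tendsto_nhds]
  intro ε hε
  filter_upwards [hlow (ε / 2) (half_pos hε), hup (ε / 2) (half_pos hε),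
    ha.eventually_gt_atTop 0] with n h1 h2 h3
  have hq : 0 < q n := (Real.exp_pos _).trans_le h1
  have l1 := (Real.le_log_iff_exp_le hq).2 h1
  have l2 := (Real.log_le_iff_le_exp hq).2 h2
  rw [Real.dist_eq, one_div, inv_mul_eq_div, abs_lt]
  constructor
  · rw [lt_sub_iff_add_lt, lt_div_iff₀ h3]
    nlinarith
  · rw [sub_lt_iff_lt_add, div_lt_iff₀ h3]
    nlinarith

/-- Constant factors cost nothing at speed `a`: any of them is absorbed by an arbitrarily small
slack `η` in the exponent. -/
lemma eventually_const_le_exp_mul {a : ℕ → ℝ} (ha : Tendsto a atTop atTop) (C : ℝ) {η : ℝ}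
    (hη : 0 < η) : ∀ᶠ n in atTop, C ≤ Real.exp (a n * η) :=
  (Real.tendsto_exp_atTop.comp (ha.atTop_mul_const hη)).eventually_ge_atTop C

section
variable {Ω : Type*} [MeasurableSpace Ω] {P : Measure Ω} [IsProbabilityMeasure P]
  {Z W : ℕ → Ω → ℝ} {a : ℕ → ℝ}

lemma eventually_mgf_bounds (ha : Tendsto a atTop atTop)
    (hint : ∀ n t, Integrable (fun ω => Real.exp (t * Z n ω)) P) {θ : ℝ}
    (hcgf : Tendsto (fun n => 1 / a n * cgf (Z n) P (a n * θ)) atTop (𝓝 (θ ^ 2 / 2)))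
    {η : ℝ} (hη : 0 < η) :
    ∀ᶠ n in atTop, Real.exp (a n * (θ ^ 2 / 2 - η)) ≤ mgf (Z n) P (a n * θ) ∧
      mgf (Z n) P (a n * θ) ≤ Real.exp (a n * (θ ^ 2 / 2 + η)) := by
  filter_upwards [Metric.tendsto_nhds.1 hcgf η hη, ha.eventually_gt_atTop 0] with n h1 h3
  rw [Real.dist_eq, one_div, inv_mul_eq_div, abs_lt, lt_sub_iff_add_lt, lt_div_iff₀ h3,
    sub_lt_iff_lt_add, div_lt_iff₀ h3] at h1
  rw [← exp_cgf (hint n _)]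
  constructor <;> apply Real.exp_le_exp.2 <;> linarith [h1.1, h1.2]

/-- Upper bound of the moderate deviation principle, from the scaled cumulant generating
functions. -/
lemma eventually_measureReal_abs_gt_le (ha : Tendsto a atTop atTop)
    (hint : ∀ n t, Integrable (fun ω => Real.exp (t * Z n ω)) P)
    (hcgf : ∀ θ, Tendsto (fun n => 1 / a n * cgf (Z n) P (a n * θ)) atTop (𝓝 (θ ^ 2 / 2)))
    {r : ℝ} (hr : 0 ≤ r) {η : ℝ} (hη : 0 < η) :
    ∀ᶠ n in atTop, P.real {ω | r < |Z n ω|} ≤ 2 * Real.exp (-(a n * (r ^ 2 / 2 - η))) := by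
  filter_upwards [eventually_mgf_bounds ha hint (hcgf r) hη,
    eventually_mgf_bounds ha hint (hcgf (-r)) hη, ha.eventually_gt_atTop 0] with n h1 h2 h3
  have hsub : {ω | r < |Z n ω|} ⊆ {ω | r ≤ Z n ω} ∪ {ω | Z n ω ≤ -r} := by
    intro ω hω
    rcases lt_abs.1 (show r < |Z n ω| from hω) with h | h
    · exact Or.inl h.le
    · exact Or.inr (show Z n ω ≤ -r by linarith)
  have u1 := measure_ge_le_exp_mul_mgf (μ := P) r (mul_nonneg h3.le hr) (hint n (a n * r))
  have u2 := measure_le_le_exp_mul_mgf (μ := P) (-r)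
    (mul_nonpos_of_nonneg_of_nonpos h3.le (neg_nonpos.2 hr)) (hint n (a n * -r))
  have e1 : Real.exp (-(a n * r) * r) * mgf (Z n) P (a n * r)
      ≤ Real.exp (-(a n * (r ^ 2 / 2 - η))) := by
    refine (mul_le_mul_of_nonneg_left h1.2 (Real.exp_pos _).le).trans (le_of_eq ?_)
    rw [← Real.exp_add]; ring_nf
  have e2 : Real.exp (-(a n * -r) * -r) * mgf (Z n) P (a n * -r)
      ≤ Real.exp (-(a n * (r ^ 2 / 2 - η))) := by
    refine (mul_le_mul_of_nonneg_left h2.2 (Real.exp_pos _).le).trans (le_of_eq ?_)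
    rw [← Real.exp_add]; ring_nf
  calc P.real {ω | r < |Z n ω|} ≤ _ := measureReal_mono hsub
    _ ≤ _ := measureReal_union_le _ _
    _ ≤ _ := by linarith

/-- Localization to the window `(r, r + 2s]`, in place of a change of measure. Left of the window,
lowering the parameter by `s` costs the factor `exp(a s (r - z)) ≥ 1`; right of it, raising the
parameter by `s` gains `exp(a s (z - r - 2s)) ≥ 1`. -/
lemma exp_mul_le_indicator_add {θ r s a z : ℝ} (ha : 0 ≤ a) (hθ : 0 ≤ θ) (hs : 0 ≤ s) :
    Real.exp (a * θ * z) ≤ Real.exp (a * θ * (r + 2 * s)) * (if r < z then 1 else 0)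
      + Real.exp (a * s * r) * Real.exp (a * (θ - s) * z)
      + Real.exp (-(a * s * (r + 2 * s))) * Real.exp (a * (θ + s) * z) := by
  rw [← Real.exp_add, ← Real.exp_add]
  have p0 : 0 ≤ Real.exp (a * θ * (r + 2 * s)) * (if r < z then (1 : ℝ) else 0) := by
    split_ifs <;> positivity
  have p1 := (Real.exp_pos (a * s * r + a * (θ - s) * z)).le
  have p2 := (Real.exp_pos (-(a * s * (r + 2 * s)) + a * (θ + s) * z)).le
  rcases le_or_gt z r with h | h
  · have : Real.exp (a * θ * z) ≤ Real.exp (a * s * r + a * (θ - s) * z) := by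
      apply Real.exp_le_exp.2
      nlinarith [mul_nonneg (mul_nonneg ha hs) (sub_nonneg.2 h)]
    linarith
  rcases le_or_gt z (r + 2 * s) with h' | h'
  · have : Real.exp (a * θ * z) ≤ Real.exp (a * θ * (r + 2 * s)) * (if r < z then 1 else 0) := by
      rw [if_pos h, mul_one]
      exact Real.exp_le_exp.2 (mul_le_mul_of_nonneg_left h' (mul_nonneg ha hθ))
    linarith
  · have : Real.exp (a * θ * z) ≤ Real.exp (-(a * s * (r + 2 * s)) + a * (θ + s) * z) := by
      apply Real.exp_le_exp.2
      nlinarith [mul_nonneg (mul_nonneg ha hs) (sub_nonneg.2 h'.le)]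
    linarith

lemma mgf_le_measureReal_gt_add {Y : Ω → ℝ} (hY : Measurable Y)
    (hint : ∀ t, Integrable (fun ω => Real.exp (t * Y ω)) P) {θ r s a : ℝ}
    (ha : 0 ≤ a) (hθ : 0 ≤ θ) (hs : 0 ≤ s) :
    mgf Y P (a * θ) ≤ Real.exp (a * θ * (r + 2 * s)) * P.real {ω | r < Y ω}
      + Real.exp (a * s * r) * mgf Y P (a * (θ - s))
      + Real.exp (-(a * s * (r + 2 * s))) * mgf Y P (a * (θ + s)) := by
  have hm : MeasurableSet {ω | r < Y ω} := measurableSet_lt measurable_const hY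
  have hi : ∫ ω, (if r < Y ω then (1 : ℝ) else 0) ∂P = P.real {ω | r < Y ω} := by
    rw [← integral_indicator_one hm]
    rfl
  have hI : Integrable (fun ω => if r < Y ω then (1 : ℝ) else 0) P :=
    (integrable_const (1 : ℝ)).indicator hm
  have i1 := hI.const_mul (Real.exp (a * θ * (r + 2 * s)))
  have i2 := (hint (a * (θ - s))).const_mul (Real.exp (a * s * r))
  have i3 := (hint (a * (θ + s))).const_mul (Real.exp (-(a * s * (r + 2 * s))))
  have i12 : Integrable (fun ω => Real.exp (a * θ * (r + 2 * s)) * (if r < Y ω then 1 else 0)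
      + Real.exp (a * s * r) * Real.exp (a * (θ - s) * Y ω)) P := i1.add i2
  calc mgf Y P (a * θ) ≤ ∫ ω, (Real.exp (a * θ * (r + 2 * s)) * (if r < Y ω then 1 else 0)
      + Real.exp (a * s * r) * Real.exp (a * (θ - s) * Y ω)
      + Real.exp (-(a * s * (r + 2 * s))) * Real.exp (a * (θ + s) * Y ω)) ∂P :=
        integral_mono (hint _) (i12.add i3)
          fun ω => exp_mul_le_indicator_add ha hθ hs
    _ = _ := by
      rw [integral_add i12 i3, integral_add i1 i2, integral_const_mul,
        integral_const_mul, integral_const_mul, hi]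
      rfl

/-- Lower bound of the moderate deviation principle, from the scaled cumulant generating
functions. -/
lemma eventually_le_measureReal_gt (ha : Tendsto a atTop atTop)
    (hZ : ∀ n, Measurable (Z n))
    (hint : ∀ n t, Integrable (fun ω => Real.exp (t * Z n ω)) P)
    (hcgf : ∀ θ, Tendsto (fun n => 1 / a n * cgf (Z n) P (a n * θ)) atTop (𝓝 (θ ^ 2 / 2)))
    {r : ℝ} (hr : 0 ≤ r) {s : ℝ} (hs : 0 < s) :
    ∀ᶠ n in atTop, Real.exp (-(a n * ((r + s) * (r + 3 * s) - (r + s) ^ 2 / 2)))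
      ≤ P.real {ω | r < Z n ω} := by
  -- The centre of the window. With this `θ` both outer terms have exponent `θ²/2 - s²/2`, so an
  -- error `s²/8` in each generating function still leaves a gap `s²/4` below `E`.
  set θ := r + s with hθ
  have hκ : 0 < s ^ 2 / 8 := by positivity
  filter_upwards [eventually_mgf_bounds ha hint (hcgf θ) hκ,
    eventually_mgf_bounds ha hint (hcgf (θ - s)) hκ,
    eventually_mgf_bounds ha hint (hcgf (θ + s)) hκ, ha.eventually_gt_atTop 0,
    eventually_const_le_exp_mul ha 4 (show 0 < s ^ 2 / 4 by positivity),
    eventually_const_le_exp_mul ha 2 (show 0 < s * θ - s ^ 2 / 8 by rw [hθ]; nlinarith)]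
    with n h0 h1 h2 h3 h4 h5
  have key := mgf_le_measureReal_gt_add (r := r) (hZ n) (hint n) (θ := θ) h3.le (by linarith) hs.le
  set E := Real.exp (a n * (θ ^ 2 / 2 - s ^ 2 / 8)) with hE
  have e1 : Real.exp (a n * s * r) * mgf (Z n) P (a n * (θ - s)) * 4 ≤ E := by
    calc _ ≤ Real.exp (a n * s * r) * Real.exp (a n * ((θ - s) ^ 2 / 2 + s ^ 2 / 8))
        * Real.exp (a n * (s ^ 2 / 4)) := by
          gcongr
          exact h1.2
      _ = E := by rw [← Real.exp_add, ← Real.exp_add, hE, hθ]; ring_nf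
  have e2 : Real.exp (-(a n * s * (r + 2 * s))) * mgf (Z n) P (a n * (θ + s)) * 4 ≤ E := by
    calc _ ≤ Real.exp (-(a n * s * (r + 2 * s))) * Real.exp (a n * ((θ + s) ^ 2 / 2 + s ^ 2 / 8))
        * Real.exp (a n * (s ^ 2 / 4)) := by
          gcongr
          exact h2.2
      _ = E := by rw [← Real.exp_add, ← Real.exp_add, hE, hθ]; ring_nf
  have e3 : E ≤ 2 * (Real.exp (a n * θ * (r + 2 * s)) * P.real {ω | r < Z n ω}) := by
    linarith [h0.1]
  have e4 : E * Real.exp (-(a n * θ * (r + 2 * s))) ≤ 2 * P.real {ω | r < Z n ω} := by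
    calc _ ≤ 2 * (Real.exp (a n * θ * (r + 2 * s)) * P.real {ω | r < Z n ω})
          * Real.exp (-(a n * θ * (r + 2 * s))) :=
          mul_le_mul_of_nonneg_right e3 (Real.exp_pos _).le
      _ = _ := by
        rw [Real.exp_neg]
        field_simp
  -- Passing from `r + 2s` to `r + 3s` frees a factor `exp(a θ s)`, which pays for the loss `s²/8`
  -- and the constant 2.
  have e5 : 2 * Real.exp (-(a n * (θ * (r + 3 * s) - θ ^ 2 / 2)))
      ≤ E * Real.exp (-(a n * θ * (r + 2 * s))) := by
    calc _ ≤ Real.exp (a n * (s * θ - s ^ 2 / 8))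
          * Real.exp (-(a n * (θ * (r + 3 * s) - θ ^ 2 / 2))) := by gcongr
      _ = _ := by rw [hE, ← Real.exp_add, ← Real.exp_add]; ring_nf
  linarith

/-- Moderate deviations of `W`, when `W` is exponentially equivalent to `Z` and the scaled
cumulant generating functions of `Z` converge to those of the standard Gaussian. -/
theorem tendsto_log_measureReal_abs_gt (ha : Tendsto a atTop atTop)
    (hZ : ∀ n, Measurable (Z n))
    (hint : ∀ n t, Integrable (fun ω => Real.exp (t * Z n ω)) P)
    (hcgf : ∀ θ, Tendsto (fun n => 1 / a n * cgf (Z n) P (a n * θ)) atTop (𝓝 (θ ^ 2 / 2)))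
    (hW : ∀ ε > 0, ∀ M : ℝ, ∀ᶠ n in atTop,
      P.real {ω | ε < |W n ω - Z n ω|} ≤ Real.exp (-(a n * M)))
    {r : ℝ} (hr : 0 < r) :
    Tendsto (fun n => 1 / a n * Real.log (P.real {ω | r < |W n ω|})) atTop
      (𝓝 (-(r ^ 2) / 2)) := by
  rw [neg_div]
  apply tendsto_log_rate_of_exp_bounds ha
  · intro η hη
    -- The exponent of `eventually_le_measureReal_gt` at threshold `r + s`; it equals `r²/2` at `s =
    -- 0`, so continuity provides `s`.
    obtain ⟨s, hs, hsη⟩ : ∃ s > 0,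
        ((r + s) + s) * ((r + s) + 3 * s) - ((r + s) + s) ^ 2 / 2 < r ^ 2 / 2 + η := by
      have hc : ContinuousAt
          (fun s : ℝ => ((r + s) + s) * ((r + s) + 3 * s) - ((r + s) + s) ^ 2 / 2) 0 := by
        fun_prop
      have h0 := hc.tendsto.eventually_lt_const (u := r ^ 2 / 2 + η) (by ring_nf; linarith)
      exact ((eventually_mem_nhdsWithin (a := (0 : ℝ)) (s := Set.Ioi 0)).and
        (h0.filter_mono nhdsWithin_le_nhds)).exists
    set c := ((r + s) + s) * ((r + s) + 3 * s) - ((r + s) + s) ^ 2 / 2 with hc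
    filter_upwards [eventually_le_measureReal_gt ha hZ hint hcgf (r := r + s) (by linarith) hs,
      hW s hs (r ^ 2 / 2 + η), ha.eventually_gt_atTop 0,
      eventually_const_le_exp_mul ha 2 (sub_pos.2 hsη)] with n h1 h2 h3 h4
    have hsub : {ω | r + s < Z n ω} ⊆ {ω | r < |W n ω|} ∪ {ω | s < |W n ω - Z n ω|} := by
      intro ω hω
      by_contra hcon
      simp only [Set.mem_union, Set.mem_ofPred_eq, not_or, not_lt] at hcon hω
      have := abs_le.1 hcon.1
      have := abs_le.1 hcon.2
      linarith
    have h5 := (measureReal_mono (μ := P) hsub).trans (measureReal_union_le _ _)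
    have h6 : 2 * Real.exp (-(a n * (r ^ 2 / 2 + η))) ≤ Real.exp (-(a n * c)) := by
      calc _ ≤ Real.exp (a n * (r ^ 2 / 2 + η - c)) * Real.exp (-(a n * (r ^ 2 / 2 + η))) := by
            gcongr
        _ = _ := by rw [← Real.exp_add]; ring_nf
    linarith
  · intro η hη
    obtain ⟨s, hs, hsr, hsη⟩ : ∃ s > 0, s < r ∧ r ^ 2 / 2 - η < (r - s) ^ 2 / 2 - s := by
      have hc : ContinuousAt (fun s : ℝ => (r - s) ^ 2 / 2 - s) 0 := by fun_prop
      have h0 := hc.tendsto.eventually_const_lt (u := r ^ 2 / 2 - η) (by ring_nf; linarith)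
      exact ((eventually_mem_nhdsWithin (a := (0 : ℝ)) (s := Set.Ioi 0)).and
        (((eventually_lt_nhds hr).and h0).filter_mono nhdsWithin_le_nhds)).exists
    set c := (r - s) ^ 2 / 2 - s with hc
    filter_upwards [eventually_measureReal_abs_gt_le ha hint hcgf (sub_nonneg.2 hsr.le) hs,
      hW s hs c, ha.eventually_gt_atTop 0,
      eventually_const_le_exp_mul ha 3 (sub_pos.2 hsη)] with n h1 h2 h3 h4
    have hsub : {ω | r < |W n ω|} ⊆ {ω | r - s < |Z n ω|} ∪ {ω | s < |W n ω - Z n ω|} := by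
      intro ω hω
      by_contra hcon
      simp only [Set.mem_union, Set.mem_ofPred_eq, not_or, not_lt] at hcon hω
      have := abs_sub_abs_le_abs_sub (W n ω) (Z n ω)
      linarith
    have h5 := (measureReal_mono (μ := P) hsub).trans (measureReal_union_le _ _)
    have h6 : 3 * Real.exp (-(a n * c)) ≤ Real.exp (-(a n * (r ^ 2 / 2 - η))) := by
      calc _ ≤ Real.exp (a n * (c - (r ^ 2 / 2 - η))) * Real.exp (-(a n * c)) := by gcongr
        _ = _ := by rw [← Real.exp_add]; ring_nf
    linarith

end

/-! ### Taylor expansion of generating functions and their limits for row sums. -/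

lemma abs_exp_sub_one_sub_id_sub_sq_le (x : ℝ) :
    |Real.exp x - 1 - x - x ^ 2 / 2| ≤ |x| ^ 3 * Real.exp |x| := by
  have h := Complex.norm_exp_sub_sum_le_norm_mul_exp (x : ℂ) 3
  have e : Complex.exp x - ∑ m ∈ Finset.range 3, (x : ℂ) ^ m / m.factorial
      = ((Real.exp x - 1 - x - x ^ 2 / 2 : ℝ) : ℂ) := by
    simp [Finset.sum_range_succ, Nat.factorial]
    ring
  rwa [e, Complex.norm_real, Complex.norm_real, Real.norm_eq_abs, Real.norm_eq_abs] at h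

/-- The available exponent `δ|y|` is split in halves: one bounds `exp(|l y|)`, the other bounds
`|y|³` through `x³/3! ≤ exp x`, whence `48 = 3! · 2³`. -/
lemma abs_exp_mul_taylor_le {δ l y : ℝ} (hδ : 0 < δ) (hl : |l| ≤ δ / 2) :
    |Real.exp (l * y) - 1 - l * y - (l * y) ^ 2 / 2|
      ≤ 48 / δ ^ 3 * |l| ^ 3 * Real.exp (δ * |y|) := by
  have h1 := abs_exp_sub_one_sub_id_sub_sq_le (l * y)
  have h2 := Real.pow_div_factorial_le_exp (x := δ / 2 * |y|) (by positivity) 3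
  have h3 : |y| ^ 3 ≤ 48 / δ ^ 3 * Real.exp (δ / 2 * |y|) := by
    have : (δ / 2 * |y|) ^ 3 / (Nat.factorial 3 : ℝ) = |y| ^ 3 * (δ ^ 3 / 48) := by
      simp [Nat.factorial]; ring
    rw [this] at h2
    calc |y| ^ 3 = 48 / δ ^ 3 * (|y| ^ 3 * (δ ^ 3 / 48)) := by field_simp
      _ ≤ _ := by gcongr
  have h4 : Real.exp (|l| * |y|) ≤ Real.exp (δ / 2 * |y|) := by gcongr
  rw [abs_mul] at h1
  calc _ ≤ _ := h1
    _ = |l| ^ 3 * |y| ^ 3 * Real.exp (|l| * |y|) := by ring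
    _ ≤ |l| ^ 3 * (48 / δ ^ 3 * Real.exp (δ / 2 * |y|)) * Real.exp (δ / 2 * |y|) := by gcongr
    _ = 48 / δ ^ 3 * |l| ^ 3 * (Real.exp (δ / 2 * |y|) * Real.exp (δ / 2 * |y|)) := by ring
    _ = _ := by rw [← Real.exp_add]; ring_nf

/-- Second order expansion at `0` of the moment generating function of a standardized variable
with an exponential moment. -/
lemma abs_mgf_sub_one_sub_sq_le {Ω : Type*} [MeasurableSpace Ω] {P : Measure Ω}
    [IsProbabilityMeasure P] {Y : Ω → ℝ} {δ C l : ℝ} (hδ : 0 < δ) (hl : |l| ≤ δ / 2)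
    (hY : Integrable Y P) (hY2 : Integrable (fun ω => Y ω ^ 2) P)
    (hexp : Integrable (fun ω => Real.exp (l * Y ω)) P)
    (hexp' : Integrable (fun ω => Real.exp (δ * |Y ω|)) P)
    (hmean : ∫ ω, Y ω ∂P = 0) (hvar : ∫ ω, Y ω ^ 2 ∂P = 1)
    (hC : ∫ ω, Real.exp (δ * |Y ω|) ∂P ≤ C) :
    |mgf Y P l - 1 - l ^ 2 / 2| ≤ 48 / δ ^ 3 * C * |l| ^ 3 := by
  have i2 : Integrable (fun ω => (l * Y ω) ^ 2 / 2) P := by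
    simpa only [mul_pow, mul_div_right_comm] using hY2.const_mul (l ^ 2 / 2)
  have i1 : Integrable (fun ω => Real.exp (l * Y ω) - 1) P := hexp.sub (integrable_const _)
  have i1' : Integrable (fun ω => Real.exp (l * Y ω) - 1 - l * Y ω) P := i1.sub (hY.const_mul l)
  have e : mgf Y P l - 1 - l ^ 2 / 2
      = ∫ ω, (Real.exp (l * Y ω) - 1 - l * Y ω - (l * Y ω) ^ 2 / 2) ∂P := by
    rw [integral_sub i1' i2, integral_sub i1 (hY.const_mul l),
      integral_sub hexp (integrable_const _), integral_const_mul, hmean]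
    have : ∫ ω, (l * Y ω) ^ 2 / 2 ∂P = l ^ 2 / 2 := by
      simp_rw [mul_pow, mul_div_right_comm]
      rw [integral_const_mul, hvar, mul_one]
    rw [this]
    simp [mgf]
  rw [e]
  calc _ ≤ ∫ ω, |Real.exp (l * Y ω) - 1 - l * Y ω - (l * Y ω) ^ 2 / 2| ∂P :=
        abs_integral_le_integral_abs
    _ ≤ ∫ ω, 48 / δ ^ 3 * |l| ^ 3 * Real.exp (δ * |Y ω|) ∂P :=
        integral_mono (i1'.sub i2).abs (hexp'.const_mul _) fun ω => abs_exp_mul_taylor_le hδ hl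
    _ = 48 / δ ^ 3 * |l| ^ 3 * ∫ ω, Real.exp (δ * |Y ω|) ∂P := integral_const_mul _ _
    _ ≤ 48 / δ ^ 3 * |l| ^ 3 * C := by gcongr
    _ = _ := by ring

/-- If `m n - 1 = l n ^ 2 / 2 + O(|l n| ^ 3)` with `l n = θ b / √n → 0`, then
`n / b ^ 2 * log (m n) → θ ^ 2 / 2`. -/
lemma tendsto_mul_log_of_taylor {b m : ℕ → ℝ} {θ D : ℝ} (hb : ∀ᶠ n in atTop, 0 < b n)
    (hbn : Tendsto (fun n : ℕ => b n / Real.sqrt n) atTop (𝓝 0))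
    (hm : ∀ᶠ n : ℕ in atTop, |m n - 1 - (θ * (b n / Real.sqrt n)) ^ 2 / 2|
      ≤ D * |θ * (b n / Real.sqrt n)| ^ 3) :
    Tendsto (fun n : ℕ => n / b n ^ 2 * Real.log (m n)) atTop (𝓝 (θ ^ 2 / 2)) := by
  set l : ℕ → ℝ := fun n => θ * (b n / Real.sqrt n) with hl
  have hl0 : Tendsto l atTop (𝓝 0) := by simpa using hbn.const_mul θ
  have hpos : ∀ᶠ n : ℕ in atTop, 0 < b n / Real.sqrt n := by
    filter_upwards [hb, eventually_gt_atTop 0] with n h1 h2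
    have : (0 : ℝ) < n := by exact_mod_cast h2
    positivity
  have hnb : ∀ n : ℕ, (n : ℝ) / b n ^ 2 = ((b n / Real.sqrt n) ^ 2)⁻¹ := fun n => by
    rw [div_pow, Real.sq_sqrt (Nat.cast_nonneg n), inv_div]
  have hu : Tendsto (fun n => m n - 1) atTop (𝓝 0) := by
    have h1 : Tendsto (fun n => m n - 1 - l n ^ 2 / 2) atTop (𝓝 0) := by
      refine squeeze_zero_norm' (a := fun n => D * |l n| ^ 3) hm ?_
      have := (hl0.abs.pow 3).const_mul D
      simpa using this
    have h2 := h1.add ((hl0.pow 2).div_const 2)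
    simpa using h2
  have hscale : Tendsto (fun n : ℕ => n / b n ^ 2 * (m n - 1)) atTop (𝓝 (θ ^ 2 / 2)) := by
    rw [tendsto_iff_norm_sub_tendsto_zero]
    refine squeeze_zero' (g := fun n => D * |θ| ^ 3 * (b n / Real.sqrt n))
      (.of_forall fun _ => norm_nonneg _) ?_ (by simpa using hbn.const_mul (D * |θ| ^ 3))
    filter_upwards [hm, hpos] with n h1 h2
    rw [hnb]
    set x := b n / Real.sqrt n
    have : (x ^ 2)⁻¹ * (m n - 1) - θ ^ 2 / 2 = (x ^ 2)⁻¹ * (m n - 1 - (θ * x) ^ 2 / 2) := by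
      field_simp
    rw [this, norm_mul, Real.norm_of_nonneg (by positivity), Real.norm_eq_abs]
    calc _ ≤ (x ^ 2)⁻¹ * (D * |θ * x| ^ 3) := by gcongr
      _ = _ := by
        rw [abs_mul, abs_of_pos h2]
        field_simp
  -- With `u = m n - 1`, the logarithm is squeezed by `u / (1 + u) ≤ log (1 + u) ≤ u`.
  have hlow : Tendsto (fun n : ℕ => n / b n ^ 2 * (m n - 1) / (1 + (m n - 1))) atTop
      (𝓝 (θ ^ 2 / 2)) := by
    have := hscale.div (hu.const_add 1) (by norm_num)
    simpa using! this
  refine tendsto_of_tendsto_of_tendsto_of_le_of_le' hlow hscale ?_ ?_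
  · filter_upwards [hu.eventually_const_lt (show (-1 : ℝ) < 0 by norm_num)] with n h
    have hm0 : 0 < m n := by linarith
    rw [mul_div_assoc]
    refine mul_le_mul_of_nonneg_left ?_ (by positivity)
    have := Real.one_sub_inv_le_log_of_pos hm0
    refine le_trans (le_of_eq ?_) this
    rw [add_sub_cancel]
    field_simp
  · filter_upwards [hu.eventually_const_lt (show (-1 : ℝ) < 0 by norm_num)] with n h
    have hm0 : 0 < m n := by linarith
    exact mul_le_mul_of_nonneg_left (Real.log_le_sub_one_of_pos hm0) (by positivity)

/-- Scaled cumulant generating functions of the normalized row sums of a triangular array. -/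
lemma tendsto_cgf_sum_of_iIndepFun {Ω : Type*} [MeasurableSpace Ω] {P : Measure Ω}
    [IsProbabilityMeasure P] {Y : ∀ n : ℕ, Fin n → Ω → ℝ} {b : ℕ → ℝ} {δ C : ℝ} (hδ : 0 < δ)
    (hmeas : ∀ n k, Measurable (Y n k))
    (hbdd : ∀ n k (g : ℝ → ℝ), Integrable (fun ω => g (Y n k ω)) P)
    (hindep : ∀ᶠ n in atTop, iIndepFun (Y n) P)
    (hmean : ∀ᶠ n in atTop, ∀ k, ∫ ω, Y n k ω ∂P = 0)
    (hvar : ∀ᶠ n in atTop, ∀ k, ∫ ω, Y n k ω ^ 2 ∂P = 1)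
    (hident : ∀ᶠ n in atTop, ∀ j k, IdentDistrib (Y n j) (Y n k) P P)
    (hC : ∀ᶠ n in atTop, ∀ k, ∫ ω, Real.exp (δ * |Y n k ω|) ∂P ≤ C)
    (hb : ∀ᶠ n in atTop, 0 < b n)
    (hbn : Tendsto (fun n : ℕ => b n / Real.sqrt n) atTop (𝓝 0)) (θ : ℝ) :
    Tendsto (fun n : ℕ => 1 / b n ^ 2 *
      cgf (fun ω => 1 / (b n * Real.sqrt n) * ∑ k, Y n k ω) P (b n ^ 2 * θ)) atTop
      (𝓝 (θ ^ 2 / 2)) := by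
  classical
  -- The common generating function of row `n`, read off its first entry; row 0 is empty and gets a
  -- dummy value.
  set m : ℕ → ℝ := fun n => if h : 0 < n then mgf (Y n ⟨0, h⟩) P (θ * (b n / Real.sqrt n)) else 0
    with hm
  have hlog := tendsto_mul_log_of_taylor (m := m) (θ := θ) (D := 48 / δ ^ 3 * C) hb hbn ?_
  · refine hlog.congr' ?_
    filter_upwards [hb, eventually_gt_atTop 0, hindep, hident] with n h1 h2 h3 h4
    have hn : (0 : ℝ) < n := by exact_mod_cast h2
    have hs : 0 < Real.sqrt n := Real.sqrt_pos.2 hn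
    have e1 : b n ^ 2 * θ * (1 / (b n * Real.sqrt n)) = θ * (b n / Real.sqrt n) := by
      field_simp
    have e2 : mgf (fun ω => 1 / (b n * Real.sqrt n) * ∑ k, Y n k ω) P (b n ^ 2 * θ)
        = m n ^ n := by
      have := mgf_sum_of_identDistrib (hmeas n) h3 (s := Finset.univ)
        (fun i _ j _ => h4 i j) (Finset.mem_univ ⟨0, h2⟩) (θ * (b n / Real.sqrt n))
      simp only [hm, h2, dif_pos]
      rw [Finset.card_univ, Fintype.card_fin] at this
      rw [← this, ← e1]
      simp only [mgf, Finset.sum_apply]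
      congr 1
      ext ω
      ring_nf
    rw [cgf, e2, Real.log_pow]
    ring
  · have hl0 : Tendsto (fun n : ℕ => |θ * (b n / Real.sqrt n)|) atTop (𝓝 0) := by
      simpa using (hbn.const_mul θ).abs
    filter_upwards [eventually_gt_atTop 0, hmean, hvar, hC,
      hl0.eventually_le_const (half_pos hδ)] with n h2 h3 h4 h5 h6
    simp only [hm, h2, dif_pos]
    exact abs_mgf_sub_one_sub_sq_le hδ h6 (hbdd n _ id) (hbdd n _ (· ^ 2))
      (hbdd n _ fun y => Real.exp (_ * y)) (hbdd n _ fun y => Real.exp (δ * |y|))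
      (h3 _) (h4 _) (h5 _)

/-! ### Linearization of the entropy. -/

lemma empiricalDist_nonneg {α : Type*} [DecidableEq α] {n : ℕ} (x : Fin n → α) (i : α) :
    0 ≤ empiricalDist x i := by
  unfold empiricalDist
  positivity

section Entropy
variable {α : Type*} [Fintype α] {p q : α → ℝ}

/-- The relative entropy of `q` with respect to `p` is nonnegative and at most `s ^ 2` when `q` is
within relative error `s` of `p`. -/
lemma sum_mul_log_sub_log_mem_Icc {s : ℝ} (hp : ∀ i, 0 < p i) (hp1 : ∑ i, p i = 1)
    (hq : ∀ i, 0 ≤ q i) (hq1 : ∑ i, q i = 1) (hqp : ∀ i, |q i - p i| ≤ s * p i) :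
    ∑ i, q i * (Real.log (q i) - Real.log (p i)) ∈ Set.Icc 0 (s ^ 2) := by
  constructor
  · calc (0 : ℝ) = ∑ i, (q i - p i) := by rw [Finset.sum_sub_distrib, hp1, hq1, sub_self]
      _ ≤ _ := by
        refine Finset.sum_le_sum fun i _ => ?_
        rcases (hq i).eq_or_lt with h | h
        · rw [← h]; simpa using (hp i).le
        · rw [← Real.log_div h.ne' (hp i).ne']
          have := Real.one_sub_inv_le_log_of_pos (div_pos h (hp i))
          calc q i - p i = q i * (1 - (q i / p i)⁻¹) := by
                rw [inv_div]; field_simp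
            _ ≤ _ := by gcongr
  · calc _ ≤ ∑ i, (s ^ 2 * p i + (q i - p i)) := by
          refine Finset.sum_le_sum fun i _ => ?_
          have hpi := hp i
          have h2 : (q i - p i) ^ 2 ≤ (s * p i) ^ 2 := sq_le_sq.2 ((hqp i).trans (le_abs_self _))
          rcases (hq i).eq_or_lt with h | h
          · rw [← h] at h2 ⊢
            -- A point missed by `q` has relative error 1, so `s² ≥ 1` and `s² p i - p i` is
            -- nonnegative.
            have : 1 ≤ s ^ 2 := by
              have : p i ^ 2 * 1 ≤ p i ^ 2 * s ^ 2 := by linarith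
              exact le_of_mul_le_mul_left this (by positivity)
            nlinarith
          · rw [← Real.log_div h.ne' hpi.ne']
            have := Real.log_le_sub_one_of_pos (div_pos h hpi)
            calc q i * Real.log (q i / p i) ≤ q i * (q i / p i - 1) := by gcongr
              _ = (q i - p i) ^ 2 / p i + (q i - p i) := by field_simp; ring
              _ ≤ (s * p i) ^ 2 / p i + (q i - p i) := by gcongr
              _ = _ := by field_simp
      _ = s ^ 2 := by
        rw [Finset.sum_add_distrib, ← Finset.mul_sum, Finset.sum_sub_distrib, hp1, hq1]
        ring

/-- The linearization error is exactly minus the relative entropy of `q` with respect to `p`. -/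
lemma abs_shannonEntropy_sub_sub_le {s : ℝ} (hp : ∀ i, 0 < p i) (hp1 : ∑ i, p i = 1)
    (hq : ∀ i, 0 ≤ q i) (hq1 : ∑ i, q i = 1) (hqp : ∀ i, |q i - p i| ≤ s * p i) :
    |shannonEntropy q - shannonEntropy p - -∑ i, (q i - p i) * Real.log (p i)| ≤ s ^ 2 := by
  have e : shannonEntropy q - shannonEntropy p - -∑ i, (q i - p i) * Real.log (p i)
      = -∑ i, q i * (Real.log (q i) - Real.log (p i)) := by
    simp only [shannonEntropy, sub_mul, mul_sub, Finset.sum_sub_distrib]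
    ring
  obtain ⟨h1, h2⟩ := sum_mul_log_sub_log_mem_Icc hp hp1 hq hq1 hqp
  rwa [e, abs_neg, abs_of_nonneg h1]

variable [DecidableEq α]

lemma centeredLogTerm_eq (x : α) :
    centeredLogTerm p x = -Real.log (p x) - shannonEntropy p := by
  simp [centeredLogTerm, shannonEntropy, sub_mul, Finset.sum_sub_distrib]
  ring

lemma sum_mul_centeredLogTerm (hp1 : ∑ i, p i = 1) : ∑ i, p i * centeredLogTerm p i = 0 := by
  simp only [centeredLogTerm_eq, mul_sub, Finset.sum_sub_distrib, ← Finset.sum_mul, hp1]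
  simp [shannonEntropy]

lemma sum_mul_centeredLogTerm_sq (hp1 : ∑ i, p i = 1) :
    ∑ i, p i * centeredLogTerm p i ^ 2 = logVariance p := by
  have : ∀ i, p i * centeredLogTerm p i ^ 2 = p i * Real.log (p i) ^ 2
      + 2 * shannonEntropy p * (p i * Real.log (p i)) + p i * shannonEntropy p ^ 2 := fun i => by
    rw [centeredLogTerm_eq]; ring
  simp only [this, Finset.sum_add_distrib, ← Finset.sum_mul, ← Finset.mul_sum, hp1]
  simp only [shannonEntropy, logVariance]
  ring

lemma mean_centeredLogTerm {n : ℕ} (hn : 0 < n) (x : Fin n → α) :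
    1 / (n : ℝ) * ∑ k, centeredLogTerm p (x k)
      = -∑ i, (empiricalDist x i - p i) * Real.log (p i) := by
  have hn' : (n : ℝ) ≠ 0 := by exact_mod_cast hn.ne'
  simp only [centeredLogTerm, empiricalDist, Finset.sum_neg_distrib, mul_neg]
  rw [Finset.sum_comm, Finset.mul_sum]
  congr 1
  refine Finset.sum_congr rfl fun i _ => ?_
  rw [← Finset.sum_mul, Finset.sum_sub_distrib, Finset.sum_const, Finset.card_univ,
    Fintype.card_fin, nsmul_eq_mul]
  field_simp

lemma sum_empiricalDist {n : ℕ} (hn : 0 < n) (x : Fin n → α) : ∑ i, empiricalDist x i = 1 := by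
  have hn' : (n : ℝ) ≠ 0 := by exact_mod_cast hn.ne'
  simp only [empiricalDist, ← Finset.mul_sum]
  rw [Finset.sum_comm]
  simp [hn']

end Entropy

/-! ### Concentration of empirical frequencies and laws on a finite alphabet. -/

section Probability
variable {Ω : Type*} [MeasurableSpace Ω] {P : Measure Ω} [IsProbabilityMeasure P]

/-- Two-sided Hoeffding inequality for the mean of independent `[0, 1]`-valued variables with a
common expectation. -/
lemma measureReal_abs_mean_sub_gt_le {n : ℕ} (hn : 0 < n) {V : Fin n → Ω → ℝ} {μ t : ℝ}
    (hV : ∀ k, Measurable (V k)) (hindep : iIndepFun V P)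
    (h01 : ∀ k ω, V k ω ∈ Set.Icc (0 : ℝ) 1) (hmean : ∀ k, ∫ ω, V k ω ∂P = μ) (ht : 0 ≤ t) :
    P.real {ω | t < |1 / (n : ℝ) * ∑ k, V k ω - μ|} ≤ 2 * Real.exp (-2 * n * t ^ 2) := by
  have hn' : (0 : ℝ) < n := by exact_mod_cast hn
  have hU : iIndepFun (fun k ω => V k ω - μ) P :=
    hindep.comp (fun _ y => y - μ) fun _ => by fun_prop
  have hsub : ∀ k ∈ Finset.univ,
      HasSubgaussianMGF (fun ω => V k ω - μ) ((‖(1 : ℝ) - 0‖₊ / 2) ^ 2) P := fun k _ => by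
    have := hasSubgaussianMGF_of_mem_Icc (μ := P) (hV k).aemeasurable (.of_forall (h01 k))
    rwa [hmean k] at this
  have hS : HasSubgaussianMGF _ _ P := HasSubgaussianMGF.sum_of_iIndepFun hU hsub
  have hnt : 0 ≤ n * t := by positivity
  have h1 := hS.measure_ge_le hnt
  have h2 := hS.neg.measure_ge_le hnt
  -- Each centered variable has sub-Gaussian parameter `1/4`, so the sum has `n/4`.
  have e : Real.exp (-(n * t) ^ 2 /
      (2 * ((∑ _k : Fin n, (‖(1 : ℝ) - 0‖₊ / 2) ^ 2 : NNReal) : ℝ))) = Real.exp (-2 * n * t ^ 2) := by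
    congr 1
    simp
    field_simp
  rw [e] at h1 h2
  have hss : {ω | t < |1 / (n : ℝ) * ∑ k, V k ω - μ|} ⊆
      {ω | n * t ≤ ∑ k, (V k ω - μ)} ∪ {ω | n * t ≤ (-fun ω => ∑ k, (V k ω - μ)) ω} := by
    intro ω hω
    have hω : t < |1 / (n : ℝ) * ∑ k, V k ω - μ| := hω
    have e2 : ∑ k, (V k ω - μ) = n * (1 / (n : ℝ) * ∑ k, V k ω - μ) := by
      simp [Finset.sum_sub_distrib]
      field_simp
    simp only [Set.mem_union, Set.mem_ofPred_eq, Pi.neg_apply]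
    rw [e2, ← mul_neg]
    exact (lt_abs.1 hω).imp (fun h => by gcongr) fun h => by gcongr
  calc _ ≤ _ := measureReal_mono hss
    _ ≤ _ := measureReal_union_le _ _
    _ ≤ _ := by linarith

variable {α : Type*} [Fintype α] [MeasurableSpace α] [DiscreteMeasurableSpace α]

lemma integrable_comp_of_fintype {Y : Ω → α} (hY : Measurable Y) (f : α → ℝ) :
    Integrable (fun ω => f (Y ω)) P := by
  have : IsProbabilityMeasure (P.map Y) := Measure.isProbabilityMeasure_map hY.aemeasurable
  exact (Integrable.of_finite (f := f) (μ := P.map Y)).comp_measurable hY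

lemma integral_comp_of_fintype {Y : Ω → α} (hY : Measurable Y) {p : α → ℝ}
    (hlaw : ∀ i, P.real {ω | Y ω = i} = p i) (f : α → ℝ) :
    ∫ ω, f (Y ω) ∂P = ∑ i, p i * f i := by
  have : IsProbabilityMeasure (P.map Y) := Measure.isProbabilityMeasure_map hY.aemeasurable
  have hf : Measurable f := .of_discrete
  rw [← integral_map hY.aemeasurable hf.aestronglyMeasurable,
    integral_fintype .of_finite]
  refine Finset.sum_congr rfl fun i _ => ?_
  rw [map_measureReal_apply hY (measurableSet_singleton i), smul_eq_mul, ← hlaw i]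
  rfl

lemma identDistrib_of_law_eq {Y Y' : Ω → α} (hY : Measurable Y) (hY' : Measurable Y') {p : α → ℝ}
    (hlaw : ∀ i, P.real {ω | Y ω = i} = p i) (hlaw' : ∀ i, P.real {ω | Y' ω = i} = p i) :
    IdentDistrib Y Y' P P where
  aemeasurable_fst := hY.aemeasurable
  aemeasurable_snd := hY'.aemeasurable
  map_eq := by
    refine Measure.ext_of_singleton fun i => ?_
    rw [Measure.map_apply hY (measurableSet_singleton i),
      Measure.map_apply hY' (measurableSet_singleton i),
      ← ENNReal.toReal_eq_toReal_iff' (measure_ne_top _ _) (measure_ne_top _ _)]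
    exact (hlaw i).trans (hlaw' i).symm

lemma sum_law_eq_one {Y : Ω → α} (hY : Measurable Y) {p : α → ℝ}
    (hlaw : ∀ i, P.real {ω | Y ω = i} = p i) : ∑ i, p i = 1 := by
  simpa using (integral_comp_of_fintype hY hlaw fun _ => 1).symm

variable [DecidableEq α]

/-- The plug-in entropy differs from its linearization by more than `s ^ 2` with probability
controlled by a union of Hoeffding bounds. -/
lemma measureReal_plugInEntropy_remainder_gt_le {n : ℕ} (hn : 0 < n) {X : Fin n → Ω → α}
    {p : α → ℝ} (hX : ∀ k, Measurable (X k)) (hindep : iIndepFun X P)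
    (hlaw : ∀ k i, P.real {ω | X k ω = i} = p i) (hp : ∀ i, 0 < p i) {s : ℝ} (hs : 0 ≤ s) :
    P.real {ω | s ^ 2 < |plugInEntropy (fun k => X k ω) - shannonEntropy p
        - 1 / (n : ℝ) * ∑ k, centeredLogTerm p (X k ω)|}
      ≤ 2 * ∑ i, Real.exp (-2 * n * (s * p i) ^ 2) := by
  have hp1 := sum_law_eq_one (hX ⟨0, hn⟩) (hlaw ⟨0, hn⟩)
  have hss : {ω | s ^ 2 < |plugInEntropy (fun k => X k ω) - shannonEntropy p
        - 1 / (n : ℝ) * ∑ k, centeredLogTerm p (X k ω)|}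
      ⊆ ⋃ i, {ω | s * p i < |empiricalDist (fun k => X k ω) i - p i|} := by
    intro ω hω
    by_contra hcon
    simp only [Set.mem_iUnion, Set.mem_ofPred_eq, not_exists, not_lt] at hcon hω
    rw [mean_centeredLogTerm hn] at hω
    exact hω.not_ge (abs_shannonEntropy_sub_sub_le hp hp1 (empiricalDist_nonneg _)
      (sum_empiricalDist hn _) hcon)
  refine (measureReal_mono hss).trans ((measureReal_iUnion_fintype_le _).trans ?_)
  rw [Finset.mul_sum]
  refine Finset.sum_le_sum fun i _ => ?_
  have hf : ∀ _k : Fin n, Measurable fun x : α => if x = i then (1 : ℝ) else 0 :=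
    fun _ => .of_discrete
  exact measureReal_abs_mean_sub_gt_le hn (fun k => (hf k).comp (hX k))
    (hindep.comp (fun _ x => if x = i then 1 else 0) hf)
    (fun k ω => by dsimp; split_ifs <;> simp)
    (fun k => by
      simpa using integral_comp_of_fintype (hX k) (hlaw k) fun x => if x = i then 1 else 0)
    (mul_nonneg hs (hp i).le)

end Probability

/-! ### The growth condition and the main theorem. -/

/-- The growth condition forces positive probabilities and a positive standard deviation for all
large `n`, and makes the exponential sums superexponentially small. -/
lemma eventually_of_tendsto_log_sum_exp_atBot {K : ℕ → ℕ} {p : ∀ n, Fin (K n) → ℝ} {b c : ℕ → ℝ}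
    (hne : ∀ᶠ n in atTop, Nonempty (Fin (K n))) (hb : Tendsto b atTop atTop)
    (h : Tendsto (fun n => 1 / b n ^ 2 * Real.log (∑ i, Real.exp (c n * p n i ^ 2))) atTop atBot)
    (M : ℝ) :
    ∀ᶠ n in atTop, c n ≠ 0 ∧ (∀ i, p n i ≠ 0) ∧
      2 * ∑ i, Real.exp (c n * p n i ^ 2) ≤ Real.exp (-(b n ^ 2 * M)) := by
  have hb2 : Tendsto (fun n => b n ^ 2) atTop atTop :=
    (tendsto_pow_atTop two_ne_zero).comp hb
  filter_upwards [h.eventually_lt_atBot 0, h.eventually_le_atBot (-(M + 1)), hne,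
    hb.eventually_gt_atTop 0, eventually_const_le_exp_mul hb2 2 one_pos] with n h1 h2 h3 h4 h5
  have hS : 0 < ∑ i, Real.exp (c n * p n i ^ 2) := by positivity
  have hS1 : ∑ i, Real.exp (c n * p n i ^ 2) < 1 := by
    by_contra! hcon
    exact h1.not_ge (mul_nonneg (by positivity) (Real.log_nonneg hcon))
  -- A vanishing exponent would contribute a term equal to 1 to a sum that is less than 1.
  have hne0 : ∀ i, c n * p n i ^ 2 ≠ 0 := fun i h0 => by
    have := Finset.single_le_sum (f := fun i => Real.exp (c n * p n i ^ 2))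
      (fun _ _ => (Real.exp_pos _).le) (Finset.mem_univ i)
    simp only [h0, Real.exp_zero] at this
    exact hS1.not_ge this
  refine ⟨fun h0 => hne0 h3.some (by simp [h0]), fun i h0 => hne0 i (by simp [h0]), ?_⟩
  rw [one_div, inv_mul_eq_div, div_le_iff₀ (by positivity)] at h2
  calc _ ≤ Real.exp (b n ^ 2 * 1) * Real.exp (-(M + 1) * b n ^ 2) := by
        gcongr
        exact (Real.log_le_iff_le_exp hS).1 h2
    _ = _ := by rw [← Real.exp_add]; ring_nf

theorem theorem2p3
    {Ω : Type*} [MeasurableSpace Ω] (P : Measure Ω) [IsProbabilityMeasure P]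
    (K : ℕ → ℕ) (p : ∀ n : ℕ, Fin (K n) → ℝ)
    (X : ∀ n : ℕ, Fin n → Ω → Fin (K n))
    (hXmeas : ∀ (n : ℕ) (k : Fin n), Measurable (X n k))
    (hXindep : ∀ n : ℕ, 1 ≤ n → iIndepFun (X n) P)
    (hXlaw : ∀ (n : ℕ) (k : Fin n) (i : Fin (K n)), P.real {ω | X n k ω = i} = p n i)
    (hnonunif : ∀ n : ℕ, 1 ≤ n → ∃ i j : Fin (K n), p n i ≠ p n j)
    (hexp : ∃ δ : ℝ, 0 < δ ∧ ∃ C : ℝ, ∀ (n : ℕ) (hn : 1 ≤ n),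
      ∫ ω, Real.exp (δ / logStdDev (p n) * |centeredLogTerm (p n) (X n ⟨0, hn⟩ ω)|) ∂P ≤ C)
    (b : ℕ → ℝ) (hbpos : ∀ n : ℕ, 1 ≤ n → 0 < b n)
    (hb : Tendsto b atTop atTop)
    (hbn : Tendsto (fun n : ℕ => b n / Real.sqrt n) atTop (𝓝 0))
    (hbK : ∀ ε : ℝ, 0 < ε →
      Tendsto (fun n : ℕ => 1 / b n ^ 2 * Real.log (∑ i : Fin (K n),
        Real.exp (-2 * ε * Real.sqrt n * b n * logStdDev (p n) * p n i ^ 2))) atTop atBot)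
    (r : ℝ) (hr : 0 < r) :
    Tendsto (fun n : ℕ => 1 / b n ^ 2 * Real.log (P.real {ω |
        r < Real.sqrt n / (b n * logStdDev (p n)) *
          |plugInEntropy (fun k : Fin n => X n k ω) - shannonEntropy (p n)|}))
      atTop (𝓝 (-(r ^ 2) / 2)) := by 
  obtain ⟨δ, hδ, C, hC⟩ := hexp
  have hσ0 : ∀ n, 0 ≤ logStdDev (p n) := fun n => Real.sqrt_nonneg _
  have hne : ∀ᶠ n in atTop, Nonempty (Fin (K n)) := by
    filter_upwards [eventually_ge_atTop 1] with n hn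
    exact ⟨(hnonunif n hn).choose⟩
  have hsmall := fun ε hε => eventually_of_tendsto_log_sum_exp_atBot hne hb (hbK ε hε)
  have hb2 : Tendsto (fun n => b n ^ 2) atTop atTop :=
    (tendsto_pow_atTop two_ne_zero).comp hb
  have hgood : ∀ᶠ n in atTop, 1 ≤ n ∧ 0 < b n ∧ 0 < logStdDev (p n) ∧ (∀ i, 0 < p n i) ∧
      ∑ i, p n i = 1 := by
    filter_upwards [hsmall 1 one_pos 0, eventually_ge_atTop 1] with n h1 hn
    refine ⟨hn, hbpos n hn, (hσ0 n).lt_of_ne' fun h0 => h1.1 (by simp [h0]), fun i => ?_,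
      sum_law_eq_one (hXmeas n ⟨0, hn⟩) (hXlaw n ⟨0, hn⟩)⟩
    refine lt_of_le_of_ne' ?_ (h1.2.1 i)
    rw [← hXlaw n ⟨0, hn⟩ i]
    exact measureReal_nonneg
  set Y : ∀ n : ℕ, Fin n → Ω → ℝ :=
    fun n k ω => centeredLogTerm (p n) (X n k ω) / logStdDev (p n) with hY
  set Z : ℕ → Ω → ℝ := fun n ω => 1 / (b n * Real.sqrt n) * ∑ k, Y n k ω with hZ
  set W : ℕ → Ω → ℝ := fun n ω => Real.sqrt n / (b n * logStdDev (p n)) *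
    (plugInEntropy (fun k : Fin n => X n k ω) - shannonEntropy (p n)) with hW
  have hYf : ∀ n, ∀ _k : Fin n,
      Measurable fun x : Fin (K n) => centeredLogTerm (p n) x / logStdDev (p n) :=
    fun n _ => .of_discrete
  have hYm : ∀ n k, Measurable (Y n k) := fun n k => (hYf n k).comp (hXmeas n k)
  have hZm : ∀ n, Measurable (Z n) := fun n =>
    (Finset.measurable_sum _ fun k _ => hYm n k).const_mul _
  have hcgf := tendsto_cgf_sum_of_iIndepFun (P := P) (Y := Y) (b := b) (C := C) hδ hYm
    (fun n k g => integrable_comp_of_fintype (hXmeas n k)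
      fun x => g (centeredLogTerm (p n) x / logStdDev (p n)))
    ?_ ?_ ?_ ?_ ?_ (hgood.mono fun n h => h.2.1) hbn
  · have key := tendsto_log_measureReal_abs_gt (P := P) (Z := Z) (W := W) hb2 hZm ?_ hcgf ?_ hr
    · refine key.congr' ?_
      filter_upwards [hgood] with n ⟨_, h2, h3, _⟩
      have hpos : 0 ≤ Real.sqrt n / (b n * logStdDev (p n)) := by positivity
      simp only [hW, abs_mul, abs_of_nonneg hpos]
    · intro n t
      exact integrable_comp_of_fintype (Y := fun ω k => X n k ω) (measurable_pi_lambda _ (hXmeas n))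
        fun x => Real.exp (t * (1 / (b n * Real.sqrt n) *
          ∑ k, centeredLogTerm (p n) (x k) / logStdDev (p n)))
    · intro ε hε M
      filter_upwards [hsmall ε hε M, hgood] with n h1 ⟨hn, hbn0, hσ, hp, _⟩
      have hn0 : (0 : ℝ) < n := by exact_mod_cast hn
      have hsq : 0 < Real.sqrt n := Real.sqrt_pos.2 hn0
      have hnn : (n : ℝ) = Real.sqrt n * Real.sqrt n := (Real.mul_self_sqrt hn0.le).symm
      -- Chosen so that `s²` is `ε` in the units of `W - Z`, and `2 n (s p i)²` is exactly the
      -- exponent `2 ε √n b σ (p i)²` of the growth condition.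
      set s := Real.sqrt (ε * (b n * logStdDev (p n)) / Real.sqrt n) with hs
      have hs2 : s ^ 2 = ε * (b n * logStdDev (p n)) / Real.sqrt n :=
        Real.sq_sqrt (by positivity)
      have hrem := measureReal_plugInEntropy_remainder_gt_le hn (hXmeas n) (hXindep n hn)
        (hXlaw n) hp (Real.sqrt_nonneg _ : 0 ≤ s)
      have hset : {ω | ε < |W n ω - Z n ω|} = {ω | s ^ 2 < |plugInEntropy (fun k => X n k ω)
          - shannonEntropy (p n) - 1 / (n : ℝ) * ∑ k, centeredLogTerm (p n) (X n k ω)|} := by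
        ext ω
        have e : W n ω - Z n ω = Real.sqrt n / (b n * logStdDev (p n)) *
            (plugInEntropy (fun k => X n k ω)
              - shannonEntropy (p n) - 1 / (n : ℝ) * ∑ k, centeredLogTerm (p n) (X n k ω)) := by
          simp only [hW, hZ, hY, ← Finset.sum_div]
          rw [mul_sub (Real.sqrt n / _) (_ - _)]
          congr 1
          rw [hnn, Real.sqrt_mul_self hsq.le]
          field_simp
        have hpos : 0 < Real.sqrt n / (b n * logStdDev (p n)) := by positivity
        rw [Set.mem_ofPred_eq, Set.mem_ofPred_eq, e, abs_mul, abs_of_pos hpos, hs2,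
          div_lt_iff₀ hsq, div_mul_eq_mul_div, lt_div_iff₀ (by positivity), mul_comm (Real.sqrt n)]
      rw [hset]
      refine hrem.trans (le_trans (le_of_eq ?_) h1.2.2)
      congr 1
      refine Finset.sum_congr rfl fun i _ => ?_
      congr 1
      rw [mul_pow, hs2]
      nth_rewrite 1 [hnn]
      field_simp
  · filter_upwards [eventually_ge_atTop 1] with n hn
    exact (hXindep n hn).comp (fun _ x => centeredLogTerm (p n) x / logStdDev (p n)) (hYf n)
  · filter_upwards [hgood] with n ⟨_, _, _, _, hp1⟩ k
    rw [integral_comp_of_fintype (hXmeas n k) (hXlaw n k)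
      fun x => centeredLogTerm (p n) x / logStdDev (p n)]
    simp only [← mul_div_assoc, ← Finset.sum_div, sum_mul_centeredLogTerm hp1, zero_div]
  · filter_upwards [hgood] with n ⟨_, _, hσ, _, hp1⟩ k
    rw [integral_comp_of_fintype (hXmeas n k) (hXlaw n k)
      fun x => (centeredLogTerm (p n) x / logStdDev (p n)) ^ 2]
    simp only [div_pow, ← mul_div_assoc, ← Finset.sum_div, sum_mul_centeredLogTerm_sq hp1]
    have hv : 0 < logVariance (p n) := Real.sqrt_pos.1 hσ
    rw [logStdDev, Real.sq_sqrt hv.le, div_self hv.ne']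
  · exact .of_forall fun n j k => (identDistrib_of_law_eq (hXmeas n j) (hXmeas n k)
      (hXlaw n j) (hXlaw n k)).comp (hYf n j)
  · filter_upwards [hgood] with n ⟨hn, _, hσ, _⟩ k
    -- The moment bound is assumed for the first observation only; the others have the same law, so
    -- both integrals are the same finite sum.
    refine le_trans (le_of_eq ?_) (hC n hn)
    rw [integral_comp_of_fintype (hXmeas n k) (hXlaw n k)
        fun x => Real.exp (δ * |centeredLogTerm (p n) x / logStdDev (p n)|),
      integral_comp_of_fintype (hXmeas n ⟨0, hn⟩) (hXlaw n ⟨0, hn⟩)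
        fun x => Real.exp (δ / logStdDev (p n) * |centeredLogTerm (p n) x|)]
    refine Finset.sum_congr rfl fun i _ => ?_
    rw [abs_div, abs_of_pos hσ, mul_div_assoc', div_mul_eq_mul_div]
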